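/- A **modular ortholattice** (MOL) is a bounded modular lattice $L$ with a map $x\mapsto x'$ satisfying $x\vee x'=1$, $x\wedge x'=0$, $x''=x$, and $x\le y\Rightarrow y'\le x'$. **Projective spaces.** A projective space is a set $P$ of points with a set of 3-element subsets (collinear triplets) such that: if $\{p,s,q\}$ and $\{q,t,r\}$ are collinear, $p\ne r$ and $\{p,q,r\}$ is not collinear, then there is a unique $u$ with $\{p,r,u\}$ and $\{s,t,u\}$ collinear. A subspace is a set $U\subseteq P$ such that $p,q\in U$ and $\{p,q,r\}$ collinear imply $r\in U$; the subspaces form a complete lattice $\mathcal S(P)$ whose meet is intersection and whose join $\sum$ (or $+$) is the subspace generated by the union. An anisotropic orthogonality on $P$ is a symmetric relation $\perp$ on $P$ with $p\not\perp p$ for all $p$, such that $p\perp q$, $p\perp r$ and $\{q,r,s\}$ collinear imply $p\perp s$. For $U\subseteq P$ let $U^\perp=\{q\in P\mid q\perp p\text{ for all }p\in U\}$. **MOL-spaces.** A subspace topology on $P$ is a $0$-$1$-sublattice $\mathcal O$ of $\mathcal S(P)$ closed under arbitrary joins; its members are the open subspaces. Directed systems are understood to be non-empty. A set $A\subseteq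 P$ is s-compact if whenever $A\subseteq\bigcup_{i\in I}U_i$ with a directed system of open subspaces $U_i$, then $A\subseteq U_i$ for some $i$. An s-basis of $\mathcal O$ is a $0$-sublattice $\mathcal B\subseteq\mathcal O$ such that every member of $\mathcal O$ is a directed union of members of $\mathcal B$. An MOL-space is a projective space $P$ with an anisotropic orthogonality $\perp$ and a subspace topology $\mathcal O$ such that $P$ is s-compact and $\mathcal O$ has an s-basis $\mathcal B$ with * $U^\perp\in\mathcal O$ and $U+U^\perp=P$ for all $U\in\mathcal B$; * if $p\perp q$ then $p\in U$ and $q\in U^\perp$ for some $U\in\mathcal B$. An MOL-space is Frinkian if * (strongly Hausdorff) for any finitely many points $q_1,\dots,q_n$ and any point $p\notin q_1+\dots+q_n$ there are $U,V\in\mathcal O$ with $p\in U$, $q_1,\dots,q_n\in V$ and $U\cap V=\emptyset$; and * if $P=\bigl(\bigcup_{i\in I}U_i\bigr)^{\perp\perp}$ for a directed system of open subspaces $U_i$, then $P=U_i$ for some $i\in I$. **Frink spaces.** The Frink space of an MOL $L$ has as points the maximal proper filters of $L$. Three distinct points $p,q,r$ are collinear iff $p\cap q=p\cap r=q\cap r$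 (that is, their pairwise joins in the filter lattice, ordered by reverse inclusion, coincide). The canonical orthogonality is: $p\perp q$ iff $a\le b'$ for some $a\in p$, $b\in q$. The open subspaces are the joins of the basic ones $U(a)=\{p\mid a\in p\}$, $a\in L$. **Theorem 3.14.** 1. For every MOL $L$, the Frink space of $L$ is a Frinkian MOL-space with s-basis $\{U(a)\mid a\in L\}$, and $a\mapsto U(a)$ is an isomorphism of $L$ onto the algebra of s-compact open subspaces of this space, with the operations $\cap$, $+$, $^\perp$, $\emptyset$, $P$. 2. For every Frinkian MOL-space $P$, the s-compact open subspaces form an MOL $L(P)$ with the operations $\cap$, $+$, $^\perp$, $\emptyset$, $P$, and $p\mapsto\{U\in L(P)\mid p\in U\}$ is an isomorphism of $P$ onto the Frink space of $L(P)$, that is, a bijection which preserves and reflects collinearity, orthogonality and openness of sets. 3. Two MOLs are isomorphic if and only if their Frink spaces are isomorphic (in the sense of 2.). Hence MOLs and Frinkian MOL-spaces correspond to each other bijectively up to isomorphism. -/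

import Mathlib

universe u

/-- A modular ortholattice (MOL): a bounded modular lattice with an orthocomplementation. -/
class MOL (L : Type u) extends Lattice L, BoundedOrder L, IsModularLattice L, Compl L where
  sup_compl : ∀ x : L, x ⊔ xᶜ = ⊤
  inf_compl : ∀ x : L, x ⊓ xᶜ = ⊥
  compl_compl : ∀ x : L, xᶜᶜ = x
  compl_anti : ∀ x y : L, x ≤ y → yᶜ ≤ xᶜ

/-- An isomorphism of MOLs exists. (An order isomorphism preserves joins, meets and bounds.) -/
def MOLIsomorphic (L K : Type u) [MOL L] [MOL K] : Prop :=
  ∃ e : L ≃o K, ∀ a : L, e aᶜ = (e a)ᶜ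

/-- A set of points containing with two points all points collinear with them. -/
def IsCollClosed {P : Type u} (Coll : P → P → P → Prop) (U : Set P) : Prop :=
  ∀ p ∈ U, ∀ q ∈ U, ∀ r, Coll p q r → r ∈ U

/-- The smallest set containing `S` and closed under collinearity. -/
def collSpan {P : Type u} (Coll : P → P → P → Prop) (S : Set P) : Set P :=
  ⋂₀ {V | IsCollClosed Coll V ∧ S ⊆ V}

/-- The raw data of a point set with collinear triplets, an orthogonality relation and a
family of open subspaces. All axioms are imposed by the predicates below. -/
structure OrthoSpace (P : Type u) where
  Coll : P → P → P → Prop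
  Orth : P → P → Prop
  opens : Set (Set P)

namespace OrthoSpace

variable {P : Type u} (X : OrthoSpace P)

/-- The axioms of a projective space. The first three fields say that `Coll` is a set of
3-element subsets; the last one is the triangle axiom. -/
structure IsProjective : Prop where
  swap : ∀ p q r, X.Coll p q r → X.Coll q p r
  rotate : ∀ p q r, X.Coll p q r → X.Coll q r p
  ne : ∀ p q r, X.Coll p q r → p ≠ q
  triangle : ∀ p q r s t, X.Coll p s q → X.Coll q t r → p ≠ r → ¬ X.Coll p q r →
    ∃! u, X.Coll p r u ∧ X.Coll s t u

/-- Subspaces of the projective space. -/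
def IsSubspace (U : Set P) : Prop := IsCollClosed X.Coll U

/-- The subspace generated by a set of points; joins of subspaces are spans of unions. -/
def span (S : Set P) : Set P := collSpan X.Coll S

/-- The join of two subspaces. -/
def join (U V : Set P) : Set P := X.span (U ∪ V)

/-- An anisotropic orthogonality on the points of a projective space. -/
structure IsAnisotropicOrthogonality : Prop where
  symm : ∀ p q, X.Orth p q → X.Orth q p
  coll : ∀ p q r s, X.Orth p q → X.Orth p r → X.Coll q r s → X.Orth p s
  aniso : ∀ p, ¬ X.Orth p p

/-- The points orthogonal to all points of `U`. -/
def perp (U : Set P) : Set P := {q | ∀ p ∈ U, X.Orth q p}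

/-- The open sets form a 0-1-sublattice of the lattice of subspaces that is closed under
arbitrary joins. -/
structure IsSubspaceTopology : Prop where
  isSubspace : ∀ U ∈ X.opens, X.IsSubspace U
  empty_mem : ∅ ∈ X.opens
  univ_mem : Set.univ ∈ X.opens
  inter_mem : ∀ U ∈ X.opens, ∀ V ∈ X.opens, U ∩ V ∈ X.opens
  join_mem : ∀ U ∈ X.opens, ∀ V ∈ X.opens, X.join U V ∈ X.opens
  sSup_mem : ∀ S ⊆ X.opens, X.span (⋃₀ S) ∈ X.opens

/-- A (nonempty) directed system of open subspaces. -/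
structure IsDirectedSystem (D : Set (Set P)) : Prop where
  subset_opens : D ⊆ X.opens
  nonempty : D.Nonempty
  directed : DirectedOn (· ⊆ ·) D

/-- s-compactness: each covering by a directed system of open subspaces has a covering member. -/
def IsSCompact (A : Set P) : Prop :=
  ∀ D, X.IsDirectedSystem D → A ⊆ ⋃₀ D → ∃ U ∈ D, A ⊆ U

/-- An s-basis: a 0-sublattice of open subspaces such that each open subspace is a directed
union of members. -/
structure IsSBasis (B : Set (Set P)) : Prop where
  subset_opens : B ⊆ X.opens
  empty_mem : ∅ ∈ B
  inter_mem : ∀ U ∈ B, ∀ V ∈ B, U ∩ V ∈ B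
  join_mem : ∀ U ∈ B, ∀ V ∈ B, X.join U V ∈ B
  exists_directed : ∀ U ∈ X.opens, ∃ D ⊆ B, X.IsDirectedSystem D ∧ U = ⋃₀ D

/-- MOL-spaces. The last conjunct says that the orthogonality is determined by the basis: two
points are orthogonal only if some basic `U` contains one and `Uᗮ` the other (the converse
is automatic). -/
structure IsMOLSpace : Prop where
  projective : X.IsProjective
  orthogonality : X.IsAnisotropicOrthogonality
  topology : X.IsSubspaceTopology
  sCompact : X.IsSCompact Set.univ
  exists_basis : ∃ B, X.IsSBasis B ∧
    (∀ U ∈ B, X.perp U ∈ X.opens ∧ X.join U (X.perp U) = Set.univ) ∧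
    (∀ p q, X.Orth p q → ∃ U ∈ B, p ∈ U ∧ q ∈ X.perp U)

/-- A point and a finite set of points whose span does not contain it can be separated by
disjoint open subspaces. -/
def IsStronglyHausdorff : Prop :=
  ∀ (p : P) (F : Finset P), p ∉ X.span (F : Set P) →
    ∃ U ∈ X.opens, ∃ V ∈ X.opens, p ∈ U ∧ (F : Set P) ⊆ V ∧ U ∩ V = ∅

/-- Frinkian MOL-spaces. -/
structure IsFrinkian : Prop where
  molSpace : X.IsMOLSpace
  stronglyHausdorff : X.IsStronglyHausdorff
  univ_mem_of_dense : ∀ D, X.IsDirectedSystem D →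
    X.perp (X.perp (⋃₀ D)) = Set.univ → Set.univ ∈ D

/-- The s-compact open subspaces. -/
structure SCompactOpen where
  carrier : Set P
  isOpen : carrier ∈ X.opens
  isSCompact : X.IsSCompact carrier

/-- `φ` is an isomorphism of the MOL `L` onto the algebra of s-compact open subspaces, with the
operations of the subspace lattice and `U ↦ Uᗮ`. -/
structure IsIsoOntoSCompactOpens {L : Type u} [MOL L] (φ : L → Set P) : Prop where
  injective : Function.Injective φ
  range_eq : Set.range φ = {U | U ∈ X.opens ∧ X.IsSCompact U}
  map_bot : φ ⊥ = ∅
  map_top : φ ⊤ = Set.univ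
  map_inf : ∀ a b, φ (a ⊓ b) = φ a ∩ φ b
  map_sup : ∀ a b, φ (a ⊔ b) = X.join (φ a) (φ b)
  map_compl : ∀ a, φ aᶜ = X.perp (φ a)

/-- Isomorphisms of spaces: collineations that preserve and reflect orthogonality and
openness. -/
structure IsIso {Q : Type u} (Y : OrthoSpace Q) (f : P → Q) : Prop where
  bijective : Function.Bijective f
  coll_iff : ∀ p q r, X.Coll p q r ↔ Y.Coll (f p) (f q) (f r)
  orth_iff : ∀ p q, X.Orth p q ↔ Y.Orth (f p) (f q)
  open_iff : ∀ U : Set P, U ∈ X.opens ↔ f '' U ∈ Y.opens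

end OrthoSpace

/-- The points of the Frink space: the maximal proper filters of `L`. -/
def FrinkPoint (L : Type u) [MOL L] : Type u := {F : Order.PFilter L // IsCoatom F}

namespace FrinkPoint

variable {L : Type u} [MOL L]

/-- The set of elements of the filter `p`. -/
def toSet (p : FrinkPoint L) : Set L := (p.1 : Set L)

/-- The set `U(a)` of all points below `a`, that is, of all maximal filters containing `a`. -/
def basic (a : L) : Set (FrinkPoint L) := {p | a ∈ p.toSet}

/-- Collinearity in the Frink space. In the filter lattice, ordered by reverse inclusion, the join
of two filters is their intersection, so three distinct points are collinear iff their pairwise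
intersections agree. -/
def Coll (p q r : FrinkPoint L) : Prop :=
  p ≠ q ∧ p ≠ r ∧ q ≠ r ∧
    p.toSet ∩ q.toSet = p.toSet ∩ r.toSet ∧ p.toSet ∩ r.toSet = q.toSet ∩ r.toSet

/-- The canonical orthogonality: `F ⟂ G` iff `a ⟂ b`, i.e. `a ≤ bᶜ`, for some `a ∈ F`, `b ∈ G`. -/
def Orth (p q : FrinkPoint L) : Prop :=
  ∃ a ∈ p.toSet, ∃ b ∈ q.toSet, a ≤ bᶜ

end FrinkPoint

/-- The Frink space of an MOL; the open subspaces are the joins of basic ones `U(a)`. -/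
def frinkSpace (L : Type u) [MOL L] : OrthoSpace (FrinkPoint L) where
  Coll := FrinkPoint.Coll
  Orth := FrinkPoint.Orth
  opens := {V | ∃ A : Set L, V = collSpan FrinkPoint.Coll (⋃ a ∈ A, FrinkPoint.basic a)}

/-!
The points of the Frink space of `L` are the atoms of the filter lattice of `L` (ordered by reverse
inclusion), which is modular, and collinearity is the usual one for atoms; the exchange property
makes this a projective geometry. In a projective space the subspaces satisfy the modular law, so
two comparable subspaces coincide when both are complements of the same subspace; this gives
`U(aᶜ) = U(a)ᗮ`.

If a directed system of open subspaces of the Frink space does not contain the whole space, then the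
`a` with `U(aᶜ)` inside some member form a proper filter, and a maximal filter above it is a point
orthogonal to the entire system. Hence a dense directed system contains the whole space. Conversely,
in a Frinkian MOL-space `P` a proper filter `F` of `L(P)` yields a directed system `{U | Uᗮ ∈ F}`
without the whole space, and a point orthogonal to all its members lies in every member of `F`. So
the point filters are exactly the maximal ones, and strong Hausdorffness recovers collinearity.
-/

/-! ### Atoms of modular lattices and the filter lattice -/

section ModularAtoms

variable {M : Type*} [Lattice M] [IsModularLattice M]

theorem exists_le_disjoint_sup_eq [BoundedOrder M] [ComplementedLattice M] (a b : M) :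
    ∃ c ≤ a, Disjoint b c ∧ b ⊔ c = b ⊔ a := by
  obtain ⟨c, hdisj, hsup⟩ := IsModularLattice.exists_disjoint_and_sup_eq (inf_le_left : a ⊓ b ≤ a)
  have hca : c ≤ a := le_sup_right.trans hsup.le
  refine ⟨c, hca, disjoint_iff_inf_le.2 ?_, ?_⟩
  · exact (le_inf (le_inf (inf_le_right.trans hca) inf_le_left) inf_le_right).trans hdisj.le_bot
  · rw [← hsup, ← sup_assoc, sup_eq_left.2 (inf_le_right : a ⊓ b ≤ b)]

theorem inf_sup_sup_eq_of_le_sup {a b p : M} (hpab : p ≤ a ⊔ b) : a ⊓ (p ⊔ b) ⊔ b = p ⊔ b := by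
  rw [sup_comm, ← sup_inf_assoc_of_le a (le_sup_right : b ≤ p ⊔ b), sup_comm b]
  exact inf_eq_right.2 (sup_le hpab le_sup_right)

variable [OrderBot M] {a b p r : M}

theorem covBy_sup_of_isAtom_of_not_le (hp : IsAtom p) (hpb : ¬ p ≤ b) : b ⋖ b ⊔ p := by
  apply covBy_sup_of_inf_covBy_right
  rw [inf_comm, (hp.not_le_iff_disjoint.1 hpb).eq_bot]
  exact hp.bot_covBy

theorem le_sup_exchange (hp : IsAtom p) (hrb : ¬ r ≤ b) (hr : r ≤ b ⊔ p) : p ≤ b ⊔ r := by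
  have hpb : ¬ p ≤ b := fun hpb => hrb (hr.trans (sup_le le_rfl hpb))
  have hsup : b ⊔ r = b ⊔ p :=
    ((covBy_sup_of_isAtom_of_not_le hp hpb).eq_or_eq le_sup_left
      (sup_le le_sup_left hr)).resolve_left (left_lt_sup.2 hrb).ne'
  exact hsup ▸ le_sup_right

theorem isAtom_inf_sup_of_disjoint (hp : IsAtom p) (hpb : ¬ p ≤ b) (hab : Disjoint a b)
    (hpab : p ≤ a ⊔ b) : IsAtom (a ⊓ (p ⊔ b)) := by
  have hcov : b ⋖ p ⊔ b := sup_comm b p ▸ covBy_sup_of_isAtom_of_not_le hp hpb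
  rw [← inf_sup_sup_eq_of_le_sup hpab] at hcov
  have hinf := inf_covBy_of_covBy_sup_right hcov
  rwa [(hab.mono_left inf_le_left).eq_bot, bot_covBy_iff] at hinf

theorem exists_isAtom_le_sup_of_disjoint (hp : IsAtom p) (hpa : ¬ p ≤ a) (hpb : ¬ p ≤ b)
    (hab : Disjoint a b) (hpab : p ≤ a ⊔ b) :
    ∃ q r, IsAtom q ∧ IsAtom r ∧ q ≤ a ∧ r ≤ b ∧ p ≤ q ⊔ r := by
  set q := a ⊓ (p ⊔ b)
  have hqa : q ≤ a := inf_le_left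
  have hq : IsAtom q := isAtom_inf_sup_of_disjoint hp hpb hab hpab
  have hpqb : p ≤ b ⊔ q := by
    rw [sup_comm, inf_sup_sup_eq_of_le_sup hpab]
    exact le_sup_left
  have hpq : ¬ p ≤ q := fun h => hpa (h.trans hqa)
  refine ⟨q, b ⊓ (p ⊔ q), hq, isAtom_inf_sup_of_disjoint hp hpq (hab.mono_left hqa).symm hpqb,
    hqa, inf_le_left, ?_⟩
  rw [sup_comm, inf_sup_sup_eq_of_le_sup hpqb]
  exact le_sup_left

end ModularAtoms

section FilterLattice

open OrderDual

/-- The filters of `L`, ordered by reverse inclusion, so that `L` embeds by principal filters.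
They are encoded as ideals of `Lᵒᵈ`, which Mathlib equips with a lattice structure. -/
abbrev FilterLattice (L : Type*) [LE L] : Type _ := (Order.Ideal Lᵒᵈ)ᵒᵈ

variable {L : Type*} [Lattice L]

instance [IsModularLattice L] : IsModularLattice (Order.Ideal L) where
  sup_inf_le_assoc_of_le {I} J {K} hIK := by
    rintro x ⟨hx, hxK⟩
    obtain ⟨i, hi, j, hj, hxij⟩ := Order.Ideal.mem_sup.1 hx
    refine Order.Ideal.mem_sup.2 ⟨i, hi, j ⊓ (x ⊔ i), Order.Ideal.mem_inf.2 ⟨?_, ?_⟩, ?_⟩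
    · exact J.lower inf_le_left hj
    · exact K.lower inf_le_right (Order.Ideal.sup_mem hxK (hIK hi))
    · rw [← sup_inf_assoc_of_le j le_sup_right]
      exact le_inf hxij le_sup_left

namespace FilterLattice

/-- The filters of `P` are the ideals of `Pᵒᵈ`. -/
def pfilterOrderIso {P : Type*} [Preorder P] : Order.PFilter P ≃o Order.Ideal Pᵒᵈ where
  toFun F := F.dual
  invFun I := ⟨I⟩
  map_rel_iff' := Iff.rfl

variable [BoundedOrder L]

/-- The embedding of `L` into its filter lattice. -/
def principal : BoundedLatticeHom L (FilterLattice L) where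
  toFun a := toDual (Order.Ideal.principal (toDual a))
  map_sup' _ _ := Order.Ideal.ext <| Set.ext fun x => sup_le_iff (c := ofDual x)
  map_inf' a b := le_antisymm
    (le_inf (toDual_le_toDual.2 <| Order.Ideal.principal_le_iff.2 (inf_le_left (a := a)))
      (toDual_le_toDual.2 <| Order.Ideal.principal_le_iff.2 (inf_le_right (a := a))))
    (le_toDual.2 <| Order.Ideal.principal_le_iff.2 <| Order.Ideal.mem_sup.2
      ⟨toDual a, Order.Ideal.mem_principal_self, toDual b, Order.Ideal.mem_principal_self, le_rfl⟩)
  map_top' := congrArg toDual Order.Ideal.principal_bot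
  map_bot' := congrArg toDual Order.Ideal.principal_top

theorem le_principal_iff {x : FilterLattice L} {a : L} :
    x ≤ principal a ↔ toDual a ∈ ofDual x :=
  le_toDual.trans Order.Ideal.principal_le_iff

theorem exists_disjoint_of_disjoint {x y : FilterLattice L} (hxy : Disjoint x y) :
    ∃ a b : L, x ≤ principal a ∧ y ≤ principal b ∧ Disjoint a b := by
  have htop : (⊤ : Lᵒᵈ) ∈ ofDual (x ⊓ y) := hxy.eq_bot ▸ Set.mem_univ _
  obtain ⟨a, ha, b, hb, hab⟩ := Order.Ideal.mem_sup.1 htop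
  exact ⟨ofDual a, ofDual b, le_principal_iff.2 ha, le_principal_iff.2 hb,
    disjoint_iff_inf_le.2 hab⟩

end FilterLattice
end FilterLattice

/-! ### Spans, joins and orthogonality in projective spaces -/

section Span

variable {P Q : Type u} {Coll : P → P → P → Prop}

theorem isCollClosed_collSpan (S : Set P) : IsCollClosed Coll (collSpan Coll S) :=
  fun p hp q hq r h V hV => hV.1 p (hp V hV) q (hq V hV) r h

theorem subset_collSpan (S : Set P) : S ⊆ collSpan Coll S := fun _ hp _ hV => hV.2 hp

theorem collSpan_subset {S V : Set P} (hV : IsCollClosed Coll V) (h : S ⊆ V) :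
    collSpan Coll S ⊆ V := fun _ hp => hp V ⟨hV, h⟩

theorem collSpan_mono {S T : Set P} (h : S ⊆ T) : collSpan Coll S ⊆ collSpan Coll T :=
  collSpan_subset (isCollClosed_collSpan T) (h.trans (subset_collSpan T))

theorem IsCollClosed.collSpan_eq {S : Set P} (hS : IsCollClosed Coll S) : collSpan Coll S = S :=
  (collSpan_subset hS subset_rfl).antisymm (subset_collSpan S)

theorem IsCollClosed.inter {U V : Set P} (hU : IsCollClosed Coll U) (hV : IsCollClosed Coll V) :
    IsCollClosed Coll (U ∩ V) :=
  fun p hp q hq r h => ⟨hU p hp.1 q hq.1 r h, hV p hp.2 q hq.2 r h⟩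

theorem isCollClosed_sUnion_of_directedOn {D : Set (Set P)} (hD : DirectedOn (· ⊆ ·) D)
    (h : ∀ U ∈ D, IsCollClosed Coll U) : IsCollClosed Coll (⋃₀ D) := by
  rintro p ⟨U, hU, hpU⟩ q ⟨V, hV, hqV⟩ r hr
  obtain ⟨W, hW, hUW, hVW⟩ := hD U hU V hV
  exact ⟨W, hW, h W hW p (hUW hpU) q (hVW hqV) r hr⟩

theorem image_collSpan {Coll' : Q → Q → Q → Prop} {f : P → Q} (hf : Function.Surjective f)
    (h : ∀ p q r, Coll p q r ↔ Coll' (f p) (f q) (f r)) (S : Set P) :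
    f '' collSpan Coll S = collSpan Coll' (f '' S) := by
  apply Set.Subset.antisymm
  · rw [Set.image_subset_iff]
    refine collSpan_subset (fun p hp q hq r hr => ?_) fun p hp =>
      subset_collSpan _ (Set.mem_image_of_mem f hp)
    exact isCollClosed_collSpan _ _ hp _ hq _ ((h p q r).1 hr)
  · refine collSpan_subset ?_ (Set.image_mono (subset_collSpan S))
    rintro _ ⟨p, hp, rfl⟩ _ ⟨q, hq, rfl⟩ r hr
    obtain ⟨r, rfl⟩ := hf r
    exact ⟨r, isCollClosed_collSpan _ _ hp _ hq _ ((h p q r).2 hr), rfl⟩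

end Span

namespace OrthoSpace

variable {P : Type u} {X : OrthoSpace P}

section Join

variable {U V W : Set P}

theorem left_subset_join (U V : Set P) : U ⊆ X.join U V :=
  Set.subset_union_left.trans (subset_collSpan _)

theorem right_subset_join (U V : Set P) : V ⊆ X.join U V :=
  Set.subset_union_right.trans (subset_collSpan _)

theorem join_subset (hW : X.IsSubspace W) (hU : U ⊆ W) (hV : V ⊆ W) : X.join U V ⊆ W :=
  collSpan_subset hW (Set.union_subset hU hV)

theorem join_mono_left (h : U ⊆ W) : X.join U V ⊆ X.join W V :=
  collSpan_mono (Set.union_subset_union_left V h)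

theorem join_comm (U V : Set P) : X.join U V = X.join V U :=
  congrArg X.span (Set.union_comm U V)

theorem IsSubspace.join_empty (hU : X.IsSubspace U) : X.join U ∅ = U := by
  rw [join, Set.union_empty]
  exact hU.collSpan_eq

end Join

/-- The union of `A`, `B` and all lines joining a point of `A` to a point of `B`. In a projective
space this is the join of two subspaces, even if one of them is empty. -/
def lineJoin (X : OrthoSpace P) (A B : Set P) : Set P :=
  {x | x ∈ A ∨ x ∈ B ∨ ∃ a ∈ A, ∃ b ∈ B, X.Coll a b x}

namespace IsProjective

variable {p q r s : P} {A B C : Set P}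

theorem coll_swap_left (h : X.IsProjective) (hc : X.Coll p q r) : X.Coll q p r :=
  h.swap p q r hc

theorem coll_rotate_left (h : X.IsProjective) (hc : X.Coll p q r) : X.Coll q r p :=
  h.rotate p q r hc

theorem coll_rotate_right (h : X.IsProjective) (hc : X.Coll p q r) : X.Coll r p q :=
  h.coll_rotate_left (h.coll_rotate_left hc)

theorem coll_swap_right (h : X.IsProjective) (hc : X.Coll p q r) : X.Coll p r q :=
  h.coll_swap_left (h.coll_rotate_right hc)

theorem coll_reverse (h : X.IsProjective) (hc : X.Coll p q r) : X.Coll r q p :=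
  h.coll_swap_left (h.coll_rotate_left hc)

theorem pairwise_ne_of_coll (h : X.IsProjective) (hc : X.Coll p q r) : p ≠ q ∧ p ≠ r ∧ q ≠ r :=
  ⟨h.ne _ _ _ hc, h.ne _ _ _ (h.coll_swap_right hc), h.ne _ _ _ (h.coll_rotate_left hc)⟩

theorem coll_of_coll_of_coll (h : X.IsProjective) (hr : X.Coll p q r) (hs : X.Coll p q s)
    (hrs : r ≠ s) : X.Coll p r s := by
  by_contra hn
  -- The triangle axiom with `s = t = q` yields a collinear triplet with a repeated point.
  obtain ⟨u, ⟨-, hu⟩, -⟩ := h.triangle r p s q q (h.coll_reverse hr) hs hrs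
    fun hc => hn (h.coll_swap_left hc)
  exact h.ne _ _ _ hu rfl

theorem isSubspace_singleton (h : X.IsProjective) (p : P) : X.IsSubspace {p} := by
  rintro _ rfl _ rfl r hr
  exact (h.ne _ _ _ hr rfl).elim

theorem lineJoin_comm (h : X.IsProjective) (A B : Set P) : X.lineJoin A B = X.lineJoin B A := by
  have lineJoin_subset (A B : Set P) : X.lineJoin A B ⊆ X.lineJoin B A := by
    rintro x (hx | hx | ⟨a, ha, b, hb, hx⟩)
    · exact Or.inr (Or.inl hx)
    · exact Or.inl hx
    · exact Or.inr (Or.inr ⟨b, hb, a, ha, h.coll_swap_left hx⟩)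
  exact (lineJoin_subset A B).antisymm (lineJoin_subset B A)

theorem mem_lineJoin_of_coll_left (h : X.IsProjective) (hA : X.IsSubspace A) (hp : p ∈ A)
    (hq : q ∈ X.lineJoin A B) (hr : X.Coll p q r) : r ∈ X.lineJoin A B := by
  rcases hq with hq | hq | ⟨a, ha, b, hb, hq⟩
  · exact Or.inl (hA p hp q hq r hr)
  · exact Or.inr (Or.inr ⟨p, hp, q, hq, hr⟩)
  by_cases hc : X.Coll p q a
  · exact Or.inl (hA p hp q (hA p hp a ha q (h.coll_swap_right hc)) r hr)
  rcases eq_or_ne p a with rfl | hpa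
  · rcases eq_or_ne b r with rfl | hbr
    · exact Or.inr (Or.inl hb)
    · exact Or.inr (Or.inr
        ⟨p, hp, b, hb, h.coll_of_coll_of_coll (h.coll_swap_right hq) hr hbr⟩)
  · obtain ⟨u, ⟨hpau, hrbu⟩, -⟩ :=
      h.triangle p q a r b (h.coll_swap_right hr) (h.coll_reverse hq) hpa hc
    exact Or.inr (Or.inr ⟨u, hA p hp a ha u hpau, b, hb, h.coll_reverse hrbu⟩)

theorem mem_lineJoin_of_coll_right (h : X.IsProjective) (hB : X.IsSubspace B) (hp : p ∈ B)
    (hq : q ∈ X.lineJoin A B) (hr : X.Coll p q r) : r ∈ X.lineJoin A B := by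
  rw [h.lineJoin_comm] at hq ⊢
  exact h.mem_lineJoin_of_coll_left hB hp hq hr

theorem isSubspace_lineJoin (h : X.IsProjective) (hA : X.IsSubspace A) (hB : X.IsSubspace B) :
    X.IsSubspace (X.lineJoin A B) := by
  intro p hp q hq r hr
  rcases id hp with hpA | hpB | ⟨a, ha, b, hb, hab⟩
  · exact h.mem_lineJoin_of_coll_left hA hpA hq hr
  · exact h.mem_lineJoin_of_coll_right hB hpB hq hr
  rcases eq_or_ne q a with rfl | hqa
  · exact h.mem_lineJoin_of_coll_left hA ha hp (h.coll_swap_left hr)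
  by_cases hc : X.Coll q p a
  · rcases eq_or_ne a r with rfl | har
    · exact Or.inl ha
    · have hqar : X.Coll q a r := h.coll_of_coll_of_coll hc (h.coll_swap_left hr) har
      exact h.mem_lineJoin_of_coll_left hA ha hq (h.coll_swap_left hqar)
  · obtain ⟨u, ⟨hqau, hrbu⟩, -⟩ :=
      h.triangle q p a r b (h.coll_rotate_left hr) (h.coll_reverse hab) hqa hc
    have hu : u ∈ X.lineJoin A B := h.mem_lineJoin_of_coll_left hA ha hq (h.coll_swap_left hqau)
    exact h.mem_lineJoin_of_coll_right hB hb hu (h.coll_rotate_left hrbu)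

theorem join_eq_lineJoin (h : X.IsProjective) (hA : X.IsSubspace A) (hB : X.IsSubspace B) :
    X.join A B = X.lineJoin A B := by
  apply Set.Subset.antisymm
  · exact join_subset (h.isSubspace_lineJoin hA hB) (fun x hx => Or.inl hx)
      fun x hx => Or.inr (Or.inl hx)
  · rintro x (hx | hx | ⟨a, ha, b, hb, hx⟩)
    · exact left_subset_join A B hx
    · exact right_subset_join A B hx
    · exact isCollClosed_collSpan _ a (left_subset_join A B ha) b (right_subset_join A B hb) x hx

theorem mem_span_pair (h : X.IsProjective) : r ∈ X.span {p, q} ↔ r = p ∨ r = q ∨ X.Coll p q r := by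
  change r ∈ X.join {p} {q} ↔ _
  rw [h.join_eq_lineJoin (h.isSubspace_singleton p) (h.isSubspace_singleton q)]
  simp [lineJoin]

theorem join_inter_subset_of_subset (h : X.IsProjective) (hA : X.IsSubspace A)
    (hB : X.IsSubspace B) (hC : X.IsSubspace C) (hAC : A ⊆ C) :
    X.join A B ∩ C ⊆ X.join A (B ∩ C) := by
  rw [h.join_eq_lineJoin hA hB, h.join_eq_lineJoin hA (hB.inter hC)]
  rintro x ⟨hx | hx | ⟨a, ha, b, hb, hx⟩, hxC⟩
  · exact Or.inl hx
  · exact Or.inr (Or.inl ⟨hx, hxC⟩)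
  · exact Or.inr (Or.inr
      ⟨a, ha, b, ⟨hb, hC x hxC a (hAC ha) b (h.coll_rotate_right hx)⟩, hx⟩)

theorem eq_of_subset_of_join_eq_univ_of_inter_eq_empty (h : X.IsProjective)
    (hA : X.IsSubspace A) (hB : X.IsSubspace B) (hC : X.IsSubspace C) (hAC : A ⊆ C)
    (hAB : X.join A B = Set.univ) (hBC : B ∩ C = ∅) : A = C := by
  refine hAC.antisymm fun x hx => ?_
  have hxA : x ∈ X.join A (B ∩ C) :=
    h.join_inter_subset_of_subset hA hB hC hAC ⟨hAB ▸ Set.mem_univ x, hx⟩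
  rwa [hBC, hA.join_empty] at hxA

end IsProjective

section Orthogonality

variable {U V : Set P}

theorem perp_anti (h : U ⊆ V) : X.perp V ⊆ X.perp U := fun _ hq p hp => hq p (h hp)

theorem perp_empty : X.perp ∅ = Set.univ :=
  Set.eq_univ_of_forall fun _ _ hp => hp.elim

namespace IsAnisotropicOrthogonality

theorem isSubspace_perp (h : X.IsAnisotropicOrthogonality) (U : Set P) :
    X.IsSubspace (X.perp U) :=
  fun p hp q hq r hr u hu =>
    h.symm _ _ (h.coll u p q r (h.symm _ _ (hp u hu)) (h.symm _ _ (hq u hu)) hr)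

theorem inter_perp (h : X.IsAnisotropicOrthogonality) (U : Set P) : U ∩ X.perp U = ∅ :=
  Set.eq_empty_of_forall_notMem fun p hp => h.aniso p (hp.2 p hp.1)

theorem subset_perp_perp (h : X.IsAnisotropicOrthogonality) (U : Set P) :
    U ⊆ X.perp (X.perp U) := fun p hp _ hq => h.symm _ _ (hq p hp)

theorem perp_univ (h : X.IsAnisotropicOrthogonality) : X.perp Set.univ = ∅ := by
  simpa using h.inter_perp Set.univ

end IsAnisotropicOrthogonality

end Orthogonality

end OrthoSpace

/-! ### Geometries of atoms -/

/-- The points of `X` are represented by the atoms of a lattice in such a way that three distinct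
points are collinear iff each of the corresponding atoms lies below the join of the others (the
representation only mentions one of the atoms; in a modular lattice the choice does not matter). -/
structure OrthoSpace.IsAtomGeometry {P : Type u} {M : Type*} [Lattice M] [OrderBot M]
    (X : OrthoSpace P) (α : P → M) : Prop where
  injective : Function.Injective α
  range_eq : Set.range α = {x | IsAtom x}
  coll_iff : ∀ p q r, X.Coll p q r ↔ p ≠ q ∧ p ≠ r ∧ q ≠ r ∧ α r ≤ α p ⊔ α q

namespace OrthoSpace.IsAtomGeometry

variable {P : Type u} {M : Type*} [Lattice M] [OrderBot M] {X : OrthoSpace P} {α : P → M}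
  {p q r s t : P} {a b : M}

theorem isAtom (h : X.IsAtomGeometry α) (p : P) : IsAtom (α p) := h.range_eq.subset ⟨p, rfl⟩

theorem exists_eq_of_isAtom (h : X.IsAtomGeometry α) (ha : IsAtom a) : ∃ p, α p = a :=
  h.range_eq.superset ha

theorem le_iff_eq (h : X.IsAtomGeometry α) : α p ≤ α q ↔ p = q := by
  rw [(h.isAtom q).le_iff_eq (h.isAtom p).1, h.injective.eq_iff]

theorem le_sup_of_coll (h : X.IsAtomGeometry α) (hc : X.Coll p q r) : α r ≤ α p ⊔ α q :=
  ((h.coll_iff p q r).1 hc).2.2.2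

theorem isSubspace_setOf_le (h : X.IsAtomGeometry α) (a : M) : X.IsSubspace {p | α p ≤ a} :=
  fun _ hp _ hq _ hr => (h.le_sup_of_coll hr).trans (sup_le hp hq)

theorem coll_swap (h : X.IsAtomGeometry α) (hc : X.Coll p q r) : X.Coll q p r := by
  obtain ⟨hpq, hpr, hqr, hr⟩ := (h.coll_iff p q r).1 hc
  exact (h.coll_iff q p r).2 ⟨hpq.symm, hqr, hpr, sup_comm (α p) (α q) ▸ hr⟩

variable [IsModularLattice M]

theorem coll_rotate (h : X.IsAtomGeometry α) (hc : X.Coll p q r) : X.Coll q r p := by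
  obtain ⟨hpq, hpr, hqr, hr⟩ := (h.coll_iff p q r).1 hc
  exact (h.coll_iff q r p).2 ⟨hqr, hpq.symm, hpr.symm,
    le_sup_exchange (h.isAtom p) (mt h.le_iff_eq.1 hqr.symm) (sup_comm (α p) (α q) ▸ hr)⟩

theorem not_le_sup_of_triangle (h : X.IsAtomGeometry α) (hpsq : X.Coll p s q)
    (hqtr : X.Coll q t r) (hpr : p ≠ r) (hn : ¬ X.Coll p q r) :
    ¬ α p ≤ α s ⊔ α t ∧ ¬ α s ≤ α p ⊔ α r ∧ s ≠ t := by
  obtain ⟨hps, hpq, -, -⟩ := (h.coll_iff p s q).1 hpsq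
  have hs : α s ≤ α q ⊔ α p := h.le_sup_of_coll (h.coll_swap (h.coll_rotate (h.coll_swap hpsq)))
  obtain ⟨-, hqr, -, hr⟩ := (h.coll_iff q t r).1 hqtr
  have hrpq : ¬ α r ≤ α q ⊔ α p := fun hr =>
    hn ((h.coll_iff p q r).2 ⟨hpq, hpr, hqr, sup_comm (α q) (α p) ▸ hr⟩)
  have htpq : ¬ α t ≤ α q ⊔ α p := fun ht => hrpq (hr.trans (sup_le le_sup_left ht))
  refine ⟨fun hp => htpq ?_, fun hsr => hrpq ?_, ?_⟩
  · exact (le_sup_exchange (h.isAtom t) (mt h.le_iff_eq.1 hps) hp).trans (sup_le hs le_sup_right)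
  · exact (le_sup_exchange (h.isAtom r) (mt h.le_iff_eq.1 hps.symm) hsr).trans
      (sup_le le_sup_right hs)
  · rintro rfl
    exact htpq hs

theorem isProjective (h : X.IsAtomGeometry α) : X.IsProjective where
  swap _ _ _ := h.coll_swap
  rotate _ _ _ := h.coll_rotate
  ne p q r hc := ((h.coll_iff p q r).1 hc).1
  triangle p q r s t hpsq hqtr hpr hn := by
    have hrtq : X.Coll r t q := h.coll_swap (h.coll_rotate hqtr)
    have hqsp : X.Coll q s p := h.coll_swap (h.coll_rotate hpsq)
    obtain ⟨hp, hs, hst⟩ := h.not_le_sup_of_triangle hpsq hqtr hpr hn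
    obtain ⟨hr, ht, -⟩ := h.not_le_sup_of_triangle hrtq hqsp hpr.symm fun hc =>
      hn (h.coll_swap (h.coll_rotate hc))
    rw [sup_comm] at hr ht
    have hle : α s ≤ α p ⊔ α r ⊔ α t := by
      have hspq : α s ≤ α p ⊔ α q := h.le_sup_of_coll (h.coll_rotate (h.coll_rotate hqsp))
      exact hspq.trans (sup_assoc (α p) _ _ ▸ sup_le_sup_left (h.le_sup_of_coll hrtq) _)
    obtain ⟨u, hu⟩ := h.exists_eq_of_isAtom <| isAtom_inf_sup_of_disjoint (h.isAtom s)
      (mt h.le_iff_eq.1 hst) ((h.isAtom t).not_le_iff_disjoint.1 ht).symm hle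
    have hupr : α u ≤ α p ⊔ α r := hu.trans_le inf_le_left
    have hust : α u ≤ α s ⊔ α t := hu.trans_le inf_le_right
    refine ⟨u, ⟨(h.coll_iff p r u).2 ⟨hpr, ?_, ?_, hupr⟩, (h.coll_iff s t u).2 ⟨hst, ?_, ?_, hust⟩⟩,
      fun v ⟨hprv, hstv⟩ => ?_⟩
    · rintro rfl; exact hp hust
    · rintro rfl; exact hr hust
    · rintro rfl; exact hs hupr
    · rintro rfl; exact ht hupr
    · rw [← h.le_iff_eq, hu]
      exact le_inf (h.le_sup_of_coll hprv) (h.le_sup_of_coll hstv)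

theorem mem_join_of_le_sup (h : X.IsAtomGeometry α) (hab : Disjoint a b) (hp : α p ≤ a ⊔ b) :
    p ∈ X.join {q | α q ≤ a} {q | α q ≤ b} := by
  by_cases hpa : α p ≤ a
  · exact left_subset_join _ _ hpa
  by_cases hpb : α p ≤ b
  · exact right_subset_join _ _ hpb
  obtain ⟨_, _, hq, hr, hqa, hrb, hpqr⟩ :=
    exists_isAtom_le_sup_of_disjoint (h.isAtom p) hpa hpb hab hp
  obtain ⟨q, rfl⟩ := h.exists_eq_of_isAtom hq
  obtain ⟨r, rfl⟩ := h.exists_eq_of_isAtom hr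
  refine isCollClosed_collSpan _ q (left_subset_join _ _ hqa) r (right_subset_join _ _ hrb) p
    ((h.coll_iff q r p).2 ⟨?_, ?_, ?_, hpqr⟩)
  · rintro rfl
    exact (h.isAtom q).1 ((hab.mono hqa hrb).eq_bot_of_le le_rfl)
  · rintro rfl
    exact hpa hqa
  · rintro rfl
    exact hpb hrb

theorem mem_span_of_le_finset_sup (h : X.IsAtomGeometry α) (F : Finset P) (hp : α p ≤ F.sup α) :
    p ∈ X.span (F : Set P) := by
  classical
  induction F using Finset.induction_on generalizing p with
  | empty => exact ((h.isAtom p).1 (le_bot_iff.1 hp)).elim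
  | insert q F _ ih =>
    rw [Finset.sup_insert] at hp
    have hF : X.span (F : Set P) ⊆ X.span ↑(insert q F) := collSpan_mono (by simp)
    by_cases hqF : α q ≤ F.sup α
    · exact hF (ih (hp.trans (sup_le hqF le_rfl)))
    refine join_subset (isCollClosed_collSpan _) (fun r hr => ?_) (fun r hr => hF (ih hr))
      (h.mem_join_of_le_sup ((h.isAtom q).not_le_iff_disjoint.1 hqF) hp)
    rw [h.le_iff_eq.1 hr]
    exact subset_collSpan _ (by simp)

end OrthoSpace.IsAtomGeometry

/-! ### MOL-spaces -/

namespace OrthoSpace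

variable {P : Type u} {X : OrthoSpace P}

/-- The set of s-compact open subspaces. -/
def sCompactOpens (X : OrthoSpace P) : Set (Set P) := {U | U ∈ X.opens ∧ X.IsSCompact U}

theorem isDirectedSystem_image {ι : Type*} [Preorder ι] {S : Set ι} {g : ι → Set P}
    (hne : S.Nonempty) (hdir : DirectedOn (· ≤ ·) S) (hg : Monotone g)
    (hopen : ∀ i ∈ S, g i ∈ X.opens) : X.IsDirectedSystem (g '' S) where
  subset_opens := Set.image_subset_iff.2 hopen
  nonempty := hne.image g
  directed := by
    rintro _ ⟨i, hi, rfl⟩ _ ⟨j, hj, rfl⟩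
    obtain ⟨k, hk, hik, hjk⟩ := hdir i hi j hj
    exact ⟨g k, ⟨k, hk, rfl⟩, hg hik, hg hjk⟩

theorem IsAnisotropicOrthogonality.isSCompact_univ_of_dense (h : X.IsAnisotropicOrthogonality)
    (hdense : ∀ D, X.IsDirectedSystem D → X.perp (X.perp (⋃₀ D)) = Set.univ → Set.univ ∈ D) :
    X.IsSCompact Set.univ := fun D hD hcov =>
  ⟨Set.univ, hdense D hD (by rw [Set.univ_subset_iff.1 hcov, h.perp_univ, perp_empty]), subset_rfl⟩

/-- Replacing each member `W` of a covering of `U` by `(W ∩ U) + V` yields a covering of the whole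
space, and `(W ∩ U) + V` is the whole space only if `W ∩ U = U`. -/
theorem IsSubspaceTopology.isSCompact_of_isCompl (h : X.IsSubspaceTopology)
    (hP : X.IsProjective) (hc : X.IsSCompact Set.univ) {U V : Set P} (hU : U ∈ X.opens)
    (hV : V ∈ X.opens) (hUV : U ∩ V = ∅) (hjoin : X.join U V = Set.univ) : X.IsSCompact U := by
  intro D hD hcov
  have hD' : X.IsDirectedSystem ((fun W => X.join (W ∩ U) V) '' D) :=
    isDirectedSystem_image hD.nonempty hD.directed
      (fun W W' hW => join_mono_left (Set.inter_subset_inter_left U hW))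
      fun W hW => h.join_mem _ (h.inter_mem W (hD.subset_opens hW) U hU) V hV
  obtain ⟨_, ⟨W, hW, rfl⟩, huniv⟩ := hc _ hD' <| by
    rw [← hjoin]
    refine join_subset (isCollClosed_sUnion_of_directedOn hD'.directed
      fun W hW => h.isSubspace W (hD'.subset_opens hW)) (fun x hx => ?_) ?_
    · obtain ⟨W, hW, hxW⟩ := hcov hx
      exact ⟨_, ⟨W, hW, rfl⟩, left_subset_join _ _ ⟨hxW, hx⟩⟩
    · obtain ⟨W, hW⟩ := hD.nonempty
      exact fun x hx => ⟨_, ⟨W, hW, rfl⟩, right_subset_join _ _ hx⟩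
  have hWU : W ∩ U = U := hP.eq_of_subset_of_join_eq_univ_of_inter_eq_empty
    (h.isSubspace _ (h.inter_mem W (hD.subset_opens hW) U hU)) (h.isSubspace V hV)
    (h.isSubspace U hU) Set.inter_subset_right (Set.univ_subset_iff.1 huniv)
    (Set.inter_comm V U ▸ hUV)
  exact ⟨W, hW, Set.inter_eq_right.1 hWU⟩

namespace IsMOLSpace

variable {U : Set P}

theorem sBasis_eq_sCompactOpens (h : X.IsMOLSpace) {B : Set (Set P)} (hB : X.IsSBasis B)
    (hperp : ∀ U ∈ B, X.perp U ∈ X.opens ∧ X.join U (X.perp U) = Set.univ) :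
    B = X.sCompactOpens := by
  apply Set.Subset.antisymm
  · exact fun U hU => ⟨hB.subset_opens hU, h.topology.isSCompact_of_isCompl h.projective h.sCompact
      (hB.subset_opens hU) (hperp U hU).1 (h.orthogonality.inter_perp U) (hperp U hU).2⟩
  · rintro U ⟨hU, hc⟩
    obtain ⟨D, hDB, hD, rfl⟩ := hB.exists_directed U hU
    obtain ⟨V, hV, hUV⟩ := hc D hD subset_rfl
    rw [hUV.antisymm (Set.subset_sUnion_of_mem hV)]
    exact hDB hV

theorem isSBasis_sCompactOpens (h : X.IsMOLSpace) : X.IsSBasis X.sCompactOpens := by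
  obtain ⟨B, hB, hperp, -⟩ := h.exists_basis
  exact h.sBasis_eq_sCompactOpens hB hperp ▸ hB

theorem perp_mem_opens_and_join_perp (h : X.IsMOLSpace) (hU : U ∈ X.sCompactOpens) :
    X.perp U ∈ X.opens ∧ X.join U (X.perp U) = Set.univ := by
  obtain ⟨B, hB, hperp, -⟩ := h.exists_basis
  exact hperp U (h.sBasis_eq_sCompactOpens hB hperp ▸ hU)

theorem exists_mem_sCompactOpens_of_orth (h : X.IsMOLSpace) {p q : P} (hpq : X.Orth p q) :
    ∃ U ∈ X.sCompactOpens, p ∈ U ∧ q ∈ X.perp U := by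
  obtain ⟨B, hB, hperp, horth⟩ := h.exists_basis
  exact h.sBasis_eq_sCompactOpens hB hperp ▸ horth p q hpq

theorem perp_perp (h : X.IsMOLSpace) (hU : U ∈ X.sCompactOpens) : X.perp (X.perp U) = U :=
  .symm <| h.projective.eq_of_subset_of_join_eq_univ_of_inter_eq_empty
    (h.topology.isSubspace U hU.1) (h.orthogonality.isSubspace_perp U)
    (h.orthogonality.isSubspace_perp _) (h.orthogonality.subset_perp_perp U)
    (h.perp_mem_opens_and_join_perp hU).2 (h.orthogonality.inter_perp _)

theorem perp_mem_sCompactOpens (h : X.IsMOLSpace) (hU : U ∈ X.sCompactOpens) :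
    X.perp U ∈ X.sCompactOpens := by
  obtain ⟨hopen, hjoin⟩ := h.perp_mem_opens_and_join_perp hU
  exact ⟨hopen, h.topology.isSCompact_of_isCompl h.projective h.sCompact hopen hU.1
    (Set.inter_comm U _ ▸ h.orthogonality.inter_perp U) (join_comm U _ ▸ hjoin)⟩

end IsMOLSpace

namespace SCompactOpen

/-- The element of `X.SCompactOpen` given by an s-compact open subspace. -/
abbrev ofMem {U : Set P} (hU : U ∈ X.sCompactOpens) : X.SCompactOpen := ⟨U, hU.1, hU.2⟩

theorem carrier_mem (U : X.SCompactOpen) : U.carrier ∈ X.sCompactOpens := ⟨U.isOpen, U.isSCompact⟩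

theorem carrier_injective : Function.Injective (carrier (X := X)) := by
  rintro ⟨U, _, _⟩ ⟨V, _, _⟩ rfl
  rfl

instance instPartialOrder : PartialOrder X.SCompactOpen := PartialOrder.lift _ carrier_injective

end SCompactOpen

namespace IsMOLSpace

open SCompactOpen

/-- The MOL of s-compact open subspaces of an MOL-space. -/
@[reducible]
def mol (h : X.IsMOLSpace) : MOL X.SCompactOpen where
  __ := SCompactOpen.instPartialOrder
  sup U V := ofMem (h.isSBasis_sCompactOpens.join_mem _ U.carrier_mem _ V.carrier_mem)
  inf U V := ofMem (h.isSBasis_sCompactOpens.inter_mem _ U.carrier_mem _ V.carrier_mem)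
  top := ofMem ⟨h.topology.univ_mem, h.sCompact⟩
  bot := ofMem h.isSBasis_sCompactOpens.empty_mem
  compl U := ofMem (h.perp_mem_sCompactOpens U.carrier_mem)
  le_sup_left _ _ := left_subset_join _ _
  le_sup_right _ _ := right_subset_join _ _
  sup_le _ _ W := join_subset (h.topology.isSubspace _ W.isOpen)
  inf_le_left _ _ := Set.inter_subset_left
  inf_le_right _ _ := Set.inter_subset_right
  le_inf _ _ _ := Set.subset_inter
  le_top _ := Set.subset_univ _
  bot_le _ := Set.empty_subset _
  sup_inf_le_assoc_of_le {U} V {W} := h.projective.join_inter_subset_of_subset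
    (h.topology.isSubspace _ U.isOpen) (h.topology.isSubspace _ V.isOpen)
    (h.topology.isSubspace _ W.isOpen)
  sup_compl U := carrier_injective (h.perp_mem_opens_and_join_perp U.carrier_mem).2
  inf_compl U := carrier_injective (h.orthogonality.inter_perp U.carrier)
  compl_compl U := carrier_injective (h.perp_perp U.carrier_mem)
  compl_anti _ _ := perp_anti

theorem isIsoOntoSCompactOpens_carrier (h : X.IsMOLSpace) :
    let _ := h.mol
    X.IsIsoOntoSCompactOpens (carrier (X := X)) := by
  let _ := h.mol
  refine ⟨carrier_injective, ?_, rfl, rfl, fun _ _ => rfl, fun _ _ => rfl, fun _ => rfl⟩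
  exact Set.Subset.antisymm (Set.range_subset_iff.2 carrier_mem) fun U hU => ⟨ofMem hU, rfl⟩

end IsMOLSpace

end OrthoSpace

/-! ### The Frink space -/

namespace MOL

variable {L : Type u} [MOL L] {a b : L}

theorem isCompl_compl (a : L) : IsCompl a aᶜ := .of_eq (inf_compl a) (sup_compl a)

instance : ComplementedLattice L := ⟨fun a => ⟨aᶜ, isCompl_compl a⟩⟩

theorem le_compl_of_le_compl (h : a ≤ bᶜ) : b ≤ aᶜ :=
  (compl_compl b).ge.trans (compl_anti a bᶜ h)

theorem compl_sup (a b : L) : (a ⊔ b)ᶜ = aᶜ ⊓ bᶜ :=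
  le_antisymm (le_inf (compl_anti _ _ le_sup_left) (compl_anti _ _ le_sup_right)) <|
    le_compl_of_le_compl <|
      sup_le (le_compl_of_le_compl inf_le_left) (le_compl_of_le_compl inf_le_right)

theorem compl_inf (a b : L) : (a ⊓ b)ᶜ = aᶜ ⊔ bᶜ := by
  rw [← compl_compl (aᶜ ⊔ bᶜ), compl_sup, compl_compl, compl_compl]

theorem compl_top : (⊤ : L)ᶜ = ⊥ := by simpa using inf_compl (⊤ : L)

theorem compl_bot : (⊥ : L)ᶜ = ⊤ := by simpa using sup_compl (⊥ : L)

end MOL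

namespace FrinkPoint

open OrderDual OrthoSpace FilterLattice

variable {L : Type u} [MOL L] {p q r : FrinkPoint L} {a b : L}

section Points

/-- The point `p` as an element of the filter lattice, where it is an atom because the order is
reverse inclusion. -/
def atom (p : FrinkPoint L) : FilterLattice L := toDual p.1.dual

theorem atom_le_principal_iff : p.atom ≤ principal a ↔ a ∈ p.toSet := le_principal_iff

theorem atom_le_sup_iff : r.atom ≤ p.atom ⊔ q.atom ↔ p.toSet ∩ q.toSet ⊆ r.toSet := Iff.rfl

theorem atom_injective : Function.Injective (atom (L := L)) := fun _ _ h =>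
  Subtype.ext (pfilterOrderIso.injective h)

theorem range_atom : Set.range (atom (L := L)) = {x | IsAtom x} := by
  ext x
  constructor
  · rintro ⟨p, rfl⟩
    exact isAtom_dual_iff_isCoatom.2 ((pfilterOrderIso.isCoatom_iff p.1).2 p.2)
  · intro hx
    exact ⟨⟨pfilterOrderIso.symm (ofDual x),
      (pfilterOrderIso.symm.isCoatom_iff _).2 (isCoatom_dual_iff_isAtom.2 hx)⟩, rfl⟩

theorem isAtom_atom (p : FrinkPoint L) : IsAtom p.atom := range_atom.subset ⟨p, rfl⟩

theorem atom_le_sup_exchange (h : r.atom ≤ p.atom ⊔ q.atom) (hpr : p ≠ r) :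
    q.atom ≤ p.atom ⊔ r.atom :=
  le_sup_exchange q.isAtom_atom
    (mt (p.isAtom_atom.le_iff_eq r.isAtom_atom.1).1 (atom_injective.ne hpr.symm)) h

theorem coll_iff : Coll p q r ↔ p ≠ q ∧ p ≠ r ∧ q ≠ r ∧ r.atom ≤ p.atom ⊔ q.atom := by
  refine and_congr_right fun _ => and_congr_right fun hpr => and_congr_right fun hqr => ?_
  constructor
  · rintro ⟨hpqr, -⟩ a ha
    exact (hpqr.subset ha).2
  · intro hr
    have hq : p.toSet ∩ r.toSet ⊆ q.toSet := atom_le_sup_iff.1 (atom_le_sup_exchange hr hpr)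
    have hp : q.toSet ∩ r.toSet ⊆ p.toSet :=
      atom_le_sup_iff.1 (atom_le_sup_exchange (sup_comm p.atom q.atom ▸ hr) hqr)
    exact ⟨Set.Subset.antisymm (fun a ha => ⟨ha.1, hr ha⟩) fun a ha => ⟨ha.1, hq ha⟩,
      Set.Subset.antisymm (fun a ha => ⟨hq ha, ha.2⟩) fun a ha => ⟨hp ha, ha.2⟩⟩

theorem isAtomGeometry : (frinkSpace L).IsAtomGeometry atom :=
  ⟨atom_injective, range_atom, fun _ _ _ => coll_iff⟩

theorem isProjective : (frinkSpace L).IsProjective := isAtomGeometry.isProjective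

theorem inf_mem (ha : a ∈ p.toSet) (hb : b ∈ p.toSet) : a ⊓ b ∈ p.toSet :=
  Order.PFilter.inf_mem ha hb

theorem mem_of_le (hab : a ≤ b) (ha : a ∈ p.toSet) : b ∈ p.toSet := Order.PFilter.mem_of_le hab ha

theorem top_mem (p : FrinkPoint L) : ⊤ ∈ p.toSet := Order.PFilter.top_mem

theorem bot_notMem (p : FrinkPoint L) : ⊥ ∉ p.toSet := by
  rw [← atom_le_principal_iff, map_bot, le_bot_iff]
  exact p.isAtom_atom.1

theorem notMem_of_disjoint (hab : Disjoint a b) (ha : a ∈ p.toSet) : b ∉ p.toSet := fun hb =>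
  p.bot_notMem (hab.eq_bot ▸ inf_mem ha hb)

theorem exists_superset {F : Order.PFilter L} (hF : ⊥ ∉ F) :
    ∃ p : FrinkPoint L, (F : Set L) ⊆ p.toSet := by
  have : IsCoatomic (Order.PFilter L) := pfilterOrderIso.isCoatomic_iff.2 inferInstance
  obtain rfl | ⟨G, hG, hFG⟩ := eq_top_or_exists_le_coatom F
  · exact (hF trivial).elim
  · exact ⟨⟨G, hG⟩, hFG⟩

theorem exists_mem (ha : a ≠ ⊥) : ∃ p : FrinkPoint L, a ∈ p.toSet := by
  obtain ⟨p, hp⟩ := exists_superset (F := .principal a)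
    fun h => ha (le_bot_iff.1 (Order.PFilter.mem_principal.1 h))
  exact ⟨p, hp (Order.PFilter.mem_principal.2 le_rfl)⟩

theorem orth_iff : Orth p q ↔ ∃ a ∈ p.toSet, aᶜ ∈ q.toSet := by
  constructor
  · rintro ⟨a, ha, b, hb, hab⟩
    exact ⟨a, ha, mem_of_le (MOL.le_compl_of_le_compl hab) hb⟩
  · rintro ⟨a, ha, hq⟩
    exact ⟨a, ha, aᶜ, hq, (MOL.compl_compl a).ge⟩

theorem isAnisotropicOrthogonality : (frinkSpace L).IsAnisotropicOrthogonality where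
  symm p q h := by
    obtain ⟨a, ha, hq⟩ := orth_iff.1 h
    exact orth_iff.2 ⟨aᶜ, hq, (MOL.compl_compl a).symm ▸ ha⟩
  coll p q r s hq hr hs := by
    obtain ⟨a, hap, haq⟩ := orth_iff.1 hq
    obtain ⟨b, hbp, hbr⟩ := orth_iff.1 hr
    exact orth_iff.2 ⟨a ⊓ b, inf_mem hap hbp, atom_le_sup_iff.1 (isAtomGeometry.le_sup_of_coll hs)
      ⟨mem_of_le (MOL.compl_anti _ _ inf_le_left) haq,
        mem_of_le (MOL.compl_anti _ _ inf_le_right) hbr⟩⟩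
  aniso p h := by
    obtain ⟨a, ha, ha'⟩ := orth_iff.1 h
    exact notMem_of_disjoint (MOL.isCompl_compl a).disjoint ha ha'

end Points

section Basic

theorem basic_bot : basic (⊥ : L) = ∅ := Set.eq_empty_of_forall_notMem bot_notMem

theorem basic_top : basic (⊤ : L) = Set.univ := Set.eq_univ_of_forall top_mem

theorem basic_mono : Monotone (basic (L := L)) := fun _ _ h _ => mem_of_le h

theorem basic_inf (a b : L) : basic (a ⊓ b) = basic a ∩ basic b :=
  Set.Subset.antisymm (Set.subset_inter (basic_mono inf_le_left) (basic_mono inf_le_right))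
    fun _ hp => inf_mem hp.1 hp.2

theorem basic_eq_setOf_atom_le (a : L) : basic a = {p | p.atom ≤ principal a} :=
  Set.ext fun _ => atom_le_principal_iff.symm

theorem isSubspace_basic (a : L) : (frinkSpace L).IsSubspace (basic a) :=
  basic_eq_setOf_atom_le a ▸ isAtomGeometry.isSubspace_setOf_le (principal a)

theorem basic_sup_subset_of_disjoint (hab : Disjoint a b) :
    basic (a ⊔ b) ⊆ (frinkSpace L).join (basic a) (basic b) := by
  intro p hp
  rw [basic_eq_setOf_atom_le, Set.mem_ofPred_eq, map_sup] at hp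
  rw [basic_eq_setOf_atom_le, basic_eq_setOf_atom_le]
  exact isAtomGeometry.mem_join_of_le_sup (hab.map principal) hp

theorem basic_sup (a b : L) : basic (a ⊔ b) = (frinkSpace L).join (basic a) (basic b) := by
  apply Set.Subset.antisymm
  · obtain ⟨c, hcb, hac, hsup⟩ := exists_le_disjoint_sup_eq b a
    rw [← hsup]
    exact (basic_sup_subset_of_disjoint hac).trans
      (collSpan_mono (Set.union_subset_union_right _ (basic_mono hcb)))
  · exact join_subset (isSubspace_basic _) (basic_mono le_sup_left) (basic_mono le_sup_right)

theorem basic_subset_iff : basic a ⊆ basic b ↔ a ≤ b := by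
  refine ⟨fun h => ?_, fun h => basic_mono h⟩
  obtain ⟨c, hca, hbc, hsup⟩ := exists_le_disjoint_sup_eq a b
  have hc : c = ⊥ := by
    by_contra hc
    obtain ⟨p, hp⟩ := exists_mem hc
    exact notMem_of_disjoint hbc (h (mem_of_le hca hp)) hp
  rw [hc, sup_bot_eq] at hsup
  exact hsup ▸ le_sup_right

theorem basic_injective : Function.Injective (basic (L := L)) := fun _ _ h =>
  le_antisymm (basic_subset_iff.1 h.subset) (basic_subset_iff.1 h.superset)

theorem join_basic_basic_compl (a : L) :
    (frinkSpace L).join (basic a) (basic aᶜ) = Set.univ := by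
  rw [← basic_sup, MOL.sup_compl, basic_top]

theorem basic_compl (a : L) : basic aᶜ = (frinkSpace L).perp (basic a) :=
  isProjective.eq_of_subset_of_join_eq_univ_of_inter_eq_empty (isSubspace_basic aᶜ)
    (isSubspace_basic a) (isAnisotropicOrthogonality.isSubspace_perp _)
    (fun _ hq _ hp => isAnisotropicOrthogonality.symm _ _ (orth_iff.2 ⟨a, hp, hq⟩))
    (join_comm (X := frinkSpace L) _ _ ▸ join_basic_basic_compl a)
    (isAnisotropicOrthogonality.inter_perp _)

end Basic

section Topology

variable {U V : Set (FrinkPoint L)}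

theorem span_mem_opens (hV : ∀ p ∈ V, ∃ a ∈ p.toSet, basic a ⊆ V) :
    (frinkSpace L).span V ∈ (frinkSpace L).opens := by
  have hVeq : V = ⋃ a ∈ {a : L | basic a ⊆ V}, basic a := by
    refine Set.Subset.antisymm (fun p hp => ?_) (Set.iUnion₂_subset fun a ha => ha)
    obtain ⟨a, hpa, haV⟩ := hV p hp
    exact Set.mem_iUnion₂.2 ⟨a, haV, hpa⟩
  exact ⟨_, congrArg (collSpan Coll) hVeq⟩

theorem isSubspace_of_mem_opens (hV : V ∈ (frinkSpace L).opens) : (frinkSpace L).IsSubspace V := by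
  obtain ⟨A, rfl⟩ := hV
  exact isCollClosed_collSpan _

theorem exists_basic_subset_of_mem_opens (hV : V ∈ (frinkSpace L).opens) (hp : p ∈ V) :
    ∃ a ∈ p.toSet, basic a ⊆ V := by
  have hVsub := isSubspace_of_mem_opens hV
  obtain ⟨A, rfl⟩ := hV
  refine collSpan_subset (V := {p | ∃ a ∈ p.toSet, basic a ⊆ _}) ?_ ?_ hp
  · rintro p ⟨a, hpa, ha⟩ q ⟨b, hqb, hb⟩ r hr
    refine ⟨a ⊔ b, ?_, (basic_sup a b).trans_subset (join_subset hVsub ha hb)⟩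
    exact isSubspace_basic (a ⊔ b) p (mem_of_le le_sup_left hpa) q (mem_of_le le_sup_right hqb) r hr
  · exact Set.iUnion₂_subset fun a ha p hp =>
      ⟨a, hp, (Set.subset_biUnion_of_mem (u := basic) ha).trans (subset_collSpan _)⟩

theorem mem_opens_iff : V ∈ (frinkSpace L).opens ↔
    (frinkSpace L).IsSubspace V ∧ ∀ p ∈ V, ∃ a ∈ p.toSet, basic a ⊆ V :=
  ⟨fun hV => ⟨isSubspace_of_mem_opens hV, fun _ => exists_basic_subset_of_mem_opens hV⟩,
    fun ⟨hsub, hV⟩ => hsub.collSpan_eq ▸ span_mem_opens hV⟩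

theorem basic_mem_opens (a : L) : basic a ∈ (frinkSpace L).opens :=
  mem_opens_iff.2 ⟨isSubspace_basic a, fun _ hp => ⟨a, hp, subset_rfl⟩⟩

theorem span_sUnion_mem_opens {S : Set (Set (FrinkPoint L))} (hS : S ⊆ (frinkSpace L).opens) :
    (frinkSpace L).span (⋃₀ S) ∈ (frinkSpace L).opens := by
  refine span_mem_opens ?_
  rintro p ⟨U, hU, hp⟩
  obtain ⟨a, hpa, ha⟩ := exists_basic_subset_of_mem_opens (hS hU) hp
  exact ⟨a, hpa, ha.trans (Set.subset_sUnion_of_mem hU)⟩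

theorem isSubspaceTopology : (frinkSpace L).IsSubspaceTopology where
  isSubspace _ := isSubspace_of_mem_opens
  empty_mem := basic_bot (L := L) ▸ basic_mem_opens ⊥
  univ_mem := basic_top (L := L) ▸ basic_mem_opens ⊤
  inter_mem U hU V hV := by
    refine mem_opens_iff.2 ⟨(isSubspace_of_mem_opens hU).inter (isSubspace_of_mem_opens hV), ?_⟩
    rintro p ⟨hpU, hpV⟩
    obtain ⟨a, hpa, ha⟩ := exists_basic_subset_of_mem_opens hU hpU
    obtain ⟨b, hpb, hb⟩ := exists_basic_subset_of_mem_opens hV hpV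
    exact ⟨a ⊓ b, inf_mem hpa hpb, basic_inf a b ▸ Set.inter_subset_inter ha hb⟩
  join_mem U hU V hV := by
    rw [join, ← Set.sUnion_pair]
    exact span_sUnion_mem_opens (Set.pair_subset hU hV)
  sSup_mem _ := span_sUnion_mem_opens

theorem isSBasis : (frinkSpace L).IsSBasis (Set.range (basic (L := L))) where
  subset_opens := Set.range_subset_iff.2 basic_mem_opens
  empty_mem := ⟨⊥, basic_bot⟩
  inter_mem := by
    rintro _ ⟨a, rfl⟩ _ ⟨b, rfl⟩
    exact ⟨a ⊓ b, basic_inf a b⟩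
  join_mem := by
    rintro _ ⟨a, rfl⟩ _ ⟨b, rfl⟩
    exact ⟨a ⊔ b, basic_sup a b⟩
  exists_directed U hU := by
    refine ⟨basic '' {a | basic a ⊆ U}, Set.image_subset_range _ _, isDirectedSystem_image
      ⟨⊥, basic_bot.trans_subset (Set.empty_subset U)⟩ (fun a ha b hb => ?_) basic_mono
      fun a _ => basic_mem_opens a, ?_⟩
    · exact ⟨a ⊔ b, (basic_sup a b).trans_subset (join_subset (isSubspace_of_mem_opens hU) ha hb),
        le_sup_left, le_sup_right⟩
    · refine Set.Subset.antisymm (fun p hp => ?_) (Set.sUnion_subset ?_)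
      · obtain ⟨a, hpa, ha⟩ := exists_basic_subset_of_mem_opens hU hp
        exact ⟨_, ⟨a, ha, rfl⟩, hpa⟩
      · rintro _ ⟨a, ha, rfl⟩
        exact ha

end Topology

section Frinkian

theorem exists_mem_perp_sUnion {D : Set (Set (FrinkPoint L))}
    (hD : (frinkSpace L).IsDirectedSystem D) (huniv : Set.univ ∉ D) :
    ∃ p, p ∈ (frinkSpace L).perp (⋃₀ D) := by
  have hF : Order.IsPFilter {a : L | ∃ U ∈ D, basic aᶜ ⊆ U} := by
    refine .of_def ?_ ?_ ?_
    · obtain ⟨U, hU⟩ := hD.nonempty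
      exact ⟨⊤, U, hU, by simp [MOL.compl_top, basic_bot]⟩
    · rintro a ⟨U, hU, ha⟩ b ⟨V, hV, hb⟩
      obtain ⟨W, hW, hUW, hVW⟩ := hD.directed U hU V hV
      refine ⟨a ⊓ b, ⟨W, hW, ?_⟩, inf_le_left, inf_le_right⟩
      rw [MOL.compl_inf, basic_sup]
      exact join_subset (isSubspace_of_mem_opens (hD.subset_opens hW)) (ha.trans hUW)
        (hb.trans hVW)
    · rintro a b hab ⟨U, hU, ha⟩
      exact ⟨U, hU, (basic_mono (MOL.compl_anti _ _ hab)).trans ha⟩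
  obtain ⟨p, hp⟩ := exists_superset (F := hF.toPFilter) <| by
    rintro ⟨U, hU, hbot : basic (⊥ : L)ᶜ ⊆ U⟩
    rw [MOL.compl_bot, basic_top, Set.univ_subset_iff] at hbot
    exact huniv (hbot ▸ hU)
  refine ⟨p, ?_⟩
  rintro q ⟨U, hU, hqU⟩
  obtain ⟨a, hqa, ha⟩ := exists_basic_subset_of_mem_opens (hD.subset_opens hU) hqU
  rw [← MOL.compl_compl a] at hqa ha
  exact orth_iff.2 ⟨aᶜ, hp ⟨U, hU, ha⟩, hqa⟩

theorem univ_mem_of_dense {D : Set (Set (FrinkPoint L))} (hD : (frinkSpace L).IsDirectedSystem D)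
    (hdense : (frinkSpace L).perp ((frinkSpace L).perp (⋃₀ D)) = Set.univ) : Set.univ ∈ D := by
  by_contra huniv
  obtain ⟨p, hp⟩ := exists_mem_perp_sUnion hD huniv
  exact isAnisotropicOrthogonality.aniso p (hdense.superset (Set.mem_univ p) p hp)

theorem isStronglyHausdorff : (frinkSpace L).IsStronglyHausdorff := by
  intro p F hp
  have hdisj : Disjoint p.atom (F.sup atom) := p.isAtom_atom.not_le_iff_disjoint.1
    (mt (isAtomGeometry.mem_span_of_le_finset_sup F) hp)
  obtain ⟨a, b, hpa, hFb, hab⟩ := exists_disjoint_of_disjoint hdisj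
  refine ⟨basic a, basic_mem_opens a, basic b, basic_mem_opens b, atom_le_principal_iff.1 hpa,
    fun q hq => atom_le_principal_iff.1 ((Finset.le_sup hq).trans hFb), ?_⟩
  rw [← basic_inf, hab.eq_bot, basic_bot]

theorem perp_mem_opens_and_join_perp : ∀ U ∈ Set.range (basic (L := L)),
    (frinkSpace L).perp U ∈ (frinkSpace L).opens ∧
      (frinkSpace L).join U ((frinkSpace L).perp U) = Set.univ := by
  rintro _ ⟨a, rfl⟩
  rw [← basic_compl]
  exact ⟨basic_mem_opens aᶜ, join_basic_basic_compl a⟩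

theorem isMOLSpace : (frinkSpace L).IsMOLSpace where
  projective := isProjective
  orthogonality := isAnisotropicOrthogonality
  topology := isSubspaceTopology
  sCompact := isAnisotropicOrthogonality.isSCompact_univ_of_dense fun _ => univ_mem_of_dense
  exists_basis := by
    refine ⟨_, isSBasis, perp_mem_opens_and_join_perp, fun p q hpq => ?_⟩
    obtain ⟨a, hp, hq⟩ := orth_iff.1 hpq
    exact ⟨_, ⟨a, rfl⟩, hp, basic_compl a ▸ hq⟩

theorem isFrinkian : (frinkSpace L).IsFrinkian :=
  ⟨isMOLSpace, isStronglyHausdorff, fun _ => univ_mem_of_dense⟩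

theorem isIsoOntoSCompactOpens :
    (frinkSpace L).IsIsoOntoSCompactOpens (basic (L := L)) where
  injective := basic_injective
  range_eq := isMOLSpace.sBasis_eq_sCompactOpens isSBasis perp_mem_opens_and_join_perp
  map_bot := basic_bot
  map_top := basic_top
  map_inf := basic_inf
  map_sup := basic_sup
  map_compl := basic_compl

end Frinkian

end FrinkPoint

/-! ### Representing a space by its s-compact open subspaces -/

namespace OrthoSpace

variable {P Q : Type u} {X : OrthoSpace P} {Y : OrthoSpace Q} {K L : Type u} [MOL K] [MOL L]

namespace IsIsoOntoSCompactOpens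

variable {φ : K → Set P} {a b : K} {p q r : P}

theorem subset_iff (hφ : X.IsIsoOntoSCompactOpens φ) : φ a ⊆ φ b ↔ a ≤ b := by
  rw [← inf_eq_left (a := a), ← hφ.injective.eq_iff, hφ.map_inf, Set.inter_eq_left]

theorem mem_opens (hφ : X.IsIsoOntoSCompactOpens φ) (a : K) : φ a ∈ X.opens :=
  (hφ.range_eq.subset ⟨a, rfl⟩).1

theorem molIsomorphic {ψ : L → Set P} (hφ : X.IsIsoOntoSCompactOpens φ)
    (hψ : X.IsIsoOntoSCompactOpens ψ) : MOLIsomorphic K L := by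
  let e : K ≃ L := (Equiv.ofInjective φ hφ.injective).trans
    ((Equiv.setCongr (hφ.range_eq.trans hψ.range_eq.symm)).trans
      (Equiv.ofInjective ψ hψ.injective).symm)
  have he : ∀ a, ψ (e a) = φ a := fun a => Equiv.apply_ofInjective_symm hψ.injective _
  refine ⟨⟨e, fun {a b} => ?_⟩, fun a => hψ.injective ?_⟩
  · rw [← hψ.subset_iff, he, he, hφ.subset_iff]
  · change ψ (e aᶜ) = ψ (e a)ᶜ
    rw [he, hψ.map_compl, he, hφ.map_compl]

theorem comp_orderIso (hφ : X.IsIsoOntoSCompactOpens φ) (e : L ≃o K)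
    (he : ∀ a, e aᶜ = (e a)ᶜ) : X.IsIsoOntoSCompactOpens (φ ∘ e) where
  injective := hφ.injective.comp e.injective
  range_eq := by rw [e.surjective.range_comp, hφ.range_eq]
  map_bot := by simp [hφ.map_bot]
  map_top := by simp [hφ.map_top]
  map_inf a b := by simp [hφ.map_inf]
  map_sup a b := by simp [hφ.map_sup]
  map_compl a := by simp [he, hφ.map_compl]

section MOLSpace

variable {U : Set P}

theorem exists_subset_of_mem_opens (hφ : X.IsIsoOntoSCompactOpens φ) (hX : X.IsMOLSpace)
    (hU : U ∈ X.opens) {F : Set P} (hF : F.Finite) (hFU : F ⊆ U) : ∃ a, F ⊆ φ a ∧ φ a ⊆ U := by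
  obtain ⟨D, hDB, hD, rfl⟩ := hX.isSBasis_sCompactOpens.exists_directed U hU
  obtain ⟨V, hV, hFV⟩ :=
    hD.directed.exists_mem_subset_of_finite_of_subset_sUnion hD.nonempty hF hFU
  obtain ⟨a, rfl⟩ := hφ.range_eq.superset (hDB hV)
  exact ⟨a, hFV, Set.subset_sUnion_of_mem hV⟩

theorem mem_opens_iff (hφ : X.IsIsoOntoSCompactOpens φ) (hX : X.IsMOLSpace) :
    U ∈ X.opens ↔ ∃ A : Set K, U = X.span (⋃ a ∈ A, φ a) := by
  constructor
  · intro hU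
    refine ⟨{a | φ a ⊆ U}, Set.Subset.antisymm (fun p hp => subset_collSpan _ ?_) ?_⟩
    · obtain ⟨a, hpa, ha⟩ := hφ.exists_subset_of_mem_opens hX hU (Set.finite_singleton p)
        (Set.singleton_subset_iff.2 hp)
      exact Set.mem_iUnion₂.2 ⟨a, ha, hpa rfl⟩
    · exact collSpan_subset (hX.topology.isSubspace U hU) (Set.iUnion₂_subset fun a ha => ha)
  · rintro ⟨A, rfl⟩
    rw [← Set.sUnion_image]
    exact hX.topology.sSup_mem _ (Set.image_subset_iff.2 fun a _ => hφ.mem_opens a)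

end MOLSpace

theorem exists_subset_notMem_of_notMem_span (hφ : X.IsIsoOntoSCompactOpens φ)
    (hX : X.IsFrinkian) {F : Finset P} (hp : p ∉ X.span (F : Set P)) :
    ∃ a, (F : Set P) ⊆ φ a ∧ p ∉ φ a := by
  obtain ⟨U, -, V, hV, hpU, hFV, hUV⟩ := hX.stronglyHausdorff p F hp
  obtain ⟨a, hFa, ha⟩ := hφ.exists_subset_of_mem_opens hX.molSpace hV F.finite_toSet hFV
  exact ⟨a, hFa, fun hpa => hUV.subset ⟨hpU, ha hpa⟩⟩

theorem exists_mem_notMem_of_ne (hφ : X.IsIsoOntoSCompactOpens φ) (hX : X.IsFrinkian)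
    (hpq : p ≠ q) : ∃ a, p ∈ φ a ∧ q ∉ φ a := by
  have hq : q ∉ X.span (({p} : Finset P) : Set P) := by
    rw [Finset.coe_singleton, span, (hX.molSpace.projective.isSubspace_singleton p).collSpan_eq]
    exact hpq.symm
  obtain ⟨a, hpa, hqa⟩ := hφ.exists_subset_notMem_of_notMem_span hX hq
  exact ⟨a, hpa (by simp), hqa⟩

theorem coll_iff_forall_mem (hφ : X.IsIsoOntoSCompactOpens φ) (hX : X.IsFrinkian) :
    X.Coll p q r ↔ p ≠ q ∧ p ≠ r ∧ q ≠ r ∧ ∀ a, p ∈ φ a → q ∈ φ a → r ∈ φ a := by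
  have hproj := hX.molSpace.projective
  constructor
  · intro h
    obtain ⟨hpq, hpr, hqr⟩ := hproj.pairwise_ne_of_coll h
    exact ⟨hpq, hpr, hqr, fun a hp hq =>
      hX.molSpace.topology.isSubspace _ (hφ.mem_opens a) p hp q hq r h⟩
  · rintro ⟨-, hpr, hqr, h⟩
    classical
    have hr : r ∈ X.span (({p, q} : Finset P) : Set P) := by
      by_contra hr
      obtain ⟨a, hpqa, hra⟩ := hφ.exists_subset_notMem_of_notMem_span hX hr
      exact hra (h a (hpqa (by simp)) (hpqa (by simp)))
    rw [Finset.coe_pair, hproj.mem_span_pair] at hr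
    exact (hr.resolve_left hpr.symm).resolve_left hqr.symm

/-- The filter of all elements of `K` whose image contains `p`. -/
def pointFilter (hφ : X.IsIsoOntoSCompactOpens φ) (p : P) : Order.PFilter K :=
  Order.IsPFilter.toPFilter (F := {a | p ∈ φ a}) <| .of_def
    ⟨⊤, hφ.map_top.superset (Set.mem_univ p)⟩
    (fun a ha b hb => ⟨a ⊓ b, (hφ.map_inf a b).superset ⟨ha, hb⟩, inf_le_left, inf_le_right⟩)
    (fun hab ha => hφ.subset_iff.2 hab ha)

theorem bot_notMem_pointFilter (hφ : X.IsIsoOntoSCompactOpens φ) (p : P) :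
    ⊥ ∉ hφ.pointFilter p := fun h => hφ.map_bot.subset h

theorem pointFilter_le_iff (hφ : X.IsIsoOntoSCompactOpens φ) (hX : X.IsFrinkian) :
    hφ.pointFilter p ≤ hφ.pointFilter q ↔ p = q := by
  refine ⟨fun h => ?_, fun h => h ▸ le_rfl⟩
  by_contra hpq
  obtain ⟨a, hp, hq⟩ := hφ.exists_mem_notMem_of_ne hX hpq
  exact hq (h hp)

theorem exists_le_pointFilter (hφ : X.IsIsoOntoSCompactOpens φ) (hX : X.IsFrinkian)
    {F : Order.PFilter K} (hF : ⊥ ∉ F) : ∃ x, F ≤ hφ.pointFilter x := by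
  by_contra! hno
  set D : Set (Set P) := φ '' {b | bᶜ ∈ F}
  have hD : X.IsDirectedSystem D := by
    refine isDirectedSystem_image ⟨⊥, ?_⟩ (fun a ha b hb => ⟨a ⊔ b, ?_, le_sup_left, le_sup_right⟩)
      (fun a b => hφ.subset_iff.2) fun a _ => hφ.mem_opens a
    · rw [Set.mem_ofPred_eq, MOL.compl_bot]
      exact Order.PFilter.top_mem
    · rw [Set.mem_ofPred_eq, MOL.compl_sup]
      exact Order.PFilter.inf_mem ha hb
  have hperp : X.perp (⋃₀ D) = ∅ := by
    refine Set.eq_empty_of_forall_notMem fun x hx => hno x fun a ha => ?_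
    have hac : φ aᶜ ∈ D := ⟨aᶜ, by rwa [Set.mem_ofPred_eq, MOL.compl_compl], rfl⟩
    change x ∈ φ a
    rw [← MOL.compl_compl a, hφ.map_compl]
    exact perp_anti (Set.subset_sUnion_of_mem hac) hx
  obtain ⟨b, hb, hbuniv⟩ := hX.univ_mem_of_dense D hD (by rw [hperp, perp_empty])
  obtain rfl : b = ⊤ := hφ.injective (hbuniv.trans hφ.map_top.symm)
  exact hF (MOL.compl_top (L := K) ▸ hb)

theorem isCoatom_pointFilter (hφ : X.IsIsoOntoSCompactOpens φ) (hX : X.IsFrinkian) (p : P) :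
    IsCoatom (hφ.pointFilter p) := by
  refine ⟨fun h => hφ.bot_notMem_pointFilter p (h ▸ trivial), fun F hpF => ?_⟩
  by_contra hF
  obtain ⟨q, hFq⟩ := hφ.exists_le_pointFilter hX fun hbot =>
    hF (top_le_iff.1 fun a _ => Order.PFilter.mem_of_le bot_le hbot)
  obtain rfl := (hφ.pointFilter_le_iff hX).1 (hpF.le.trans hFq)
  exact hpF.not_ge hFq

/-- The map of a Frinkian MOL-space into the Frink space of an MOL representing its s-compact
open subspaces. -/
def toFrink (hφ : X.IsIsoOntoSCompactOpens φ) (hX : X.IsFrinkian) (p : P) : FrinkPoint K :=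
  ⟨hφ.pointFilter p, hφ.isCoatom_pointFilter hX p⟩

theorem toFrink_bijective (hφ : X.IsIsoOntoSCompactOpens φ) (hX : X.IsFrinkian) :
    Function.Bijective (hφ.toFrink hX) := by
  refine ⟨fun p q h => (hφ.pointFilter_le_iff hX).1 (congrArg Subtype.val h).le, fun G => ?_⟩
  obtain ⟨p, hp⟩ := hφ.exists_le_pointFilter hX G.bot_notMem
  exact ⟨p, Subtype.ext ((G.2.le_iff_eq (hφ.isCoatom_pointFilter hX p).1).1 hp)⟩

theorem toFrink_coll_iff (hφ : X.IsIsoOntoSCompactOpens φ) (hX : X.IsFrinkian) (p q r : P) :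
    X.Coll p q r ↔ FrinkPoint.Coll (hφ.toFrink hX p) (hφ.toFrink hX q) (hφ.toFrink hX r) := by
  have hne {x y : P} : x ≠ y ↔ hφ.toFrink hX x ≠ hφ.toFrink hX y :=
    (hφ.toFrink_bijective hX).1.ne_iff.symm
  rw [hφ.coll_iff_forall_mem hX, FrinkPoint.coll_iff, FrinkPoint.atom_le_sup_iff, ← hne, ← hne,
    ← hne]
  exact and_congr_right fun _ => and_congr_right fun _ => and_congr_right fun _ =>
    forall_congr' fun _ => and_imp.symm

theorem toFrink_orth_iff (hφ : X.IsIsoOntoSCompactOpens φ) (hX : X.IsFrinkian) (p q : P) :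
    X.Orth p q ↔ FrinkPoint.Orth (hφ.toFrink hX p) (hφ.toFrink hX q) := by
  rw [FrinkPoint.orth_iff]
  constructor
  · intro h
    obtain ⟨U, hU, hp, hq⟩ := hX.molSpace.exists_mem_sCompactOpens_of_orth h
    obtain ⟨a, rfl⟩ := hφ.range_eq.superset hU
    exact ⟨a, hp, (hφ.map_compl a).superset hq⟩
  · rintro ⟨a, hp, hq⟩
    exact hX.molSpace.orthogonality.symm _ _ ((hφ.map_compl a).subset hq p hp)

theorem image_toFrink (hφ : X.IsIsoOntoSCompactOpens φ) (hX : X.IsFrinkian) (a : K) :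
    hφ.toFrink hX '' φ a = FrinkPoint.basic a :=
  Set.image_preimage_eq (FrinkPoint.basic a) (hφ.toFrink_bijective hX).2

theorem isIso_toFrink (hφ : X.IsIsoOntoSCompactOpens φ) (hX : X.IsFrinkian) :
    X.IsIso (frinkSpace K) (hφ.toFrink hX) where
  bijective := hφ.toFrink_bijective hX
  coll_iff := hφ.toFrink_coll_iff hX
  orth_iff := hφ.toFrink_orth_iff hX
  open_iff U := by
    have hspan (A : Set K) : hφ.toFrink hX '' X.span (⋃ a ∈ A, φ a) =
        collSpan FrinkPoint.Coll (⋃ a ∈ A, FrinkPoint.basic a) := by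
      rw [span, image_collSpan (hφ.toFrink_bijective hX).2 (hφ.toFrink_coll_iff hX),
        Set.image_iUnion₂]
      simp only [hφ.image_toFrink hX]
    rw [hφ.mem_opens_iff hX.molSpace]
    refine exists_congr fun A => ?_
    rw [← hspan, (hφ.toFrink_bijective hX).1.image_injective.eq_iff]

end IsIsoOntoSCompactOpens

namespace IsIso

variable {f : P → Q}

theorem symm (h : X.IsIso Y f) :
    Y.IsIso X (Equiv.ofBijective f h.bijective).symm := by
  let e := Equiv.ofBijective f h.bijective
  have he : ∀ q, f (e.symm q) = q := e.apply_symm_apply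
  refine ⟨e.symm.bijective, fun p q r => ?_, fun p q => ?_, fun U => ?_⟩
  · change _ ↔ X.Coll (e.symm p) (e.symm q) (e.symm r)
    rw [h.coll_iff, he, he, he]
  · change _ ↔ X.Orth (e.symm p) (e.symm q)
    rw [h.orth_iff, he, he]
  · change _ ↔ e.symm '' U ∈ X.opens
    rw [h.open_iff, Set.image_image]
    simp only [he, Set.image_id']

theorem preimage_mem_opens_iff (h : X.IsIso Y f) {U : Set Q} :
    f ⁻¹' U ∈ X.opens ↔ U ∈ Y.opens := by
  rw [h.open_iff, Set.image_preimage_eq U h.bijective.2]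

theorem isSCompact_image (h : X.IsIso Y f) {A : Set P} (hA : X.IsSCompact A) :
    Y.IsSCompact (f '' A) := by
  intro D hD hcov
  have hD' : X.IsDirectedSystem (Set.preimage f '' D) :=
    isDirectedSystem_image hD.nonempty hD.directed (fun _ _ => Set.preimage_mono) fun _ hV =>
      h.preimage_mem_opens_iff.2 (hD.subset_opens hV)
  obtain ⟨_, ⟨V, hV, rfl⟩, hAV⟩ := hA _ hD' fun p hp => by
    obtain ⟨V, hV, hpV⟩ := hcov ⟨p, hp, rfl⟩
    exact ⟨_, ⟨V, hV, rfl⟩, hpV⟩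
  exact ⟨V, hV, Set.image_subset_iff.2 hAV⟩

theorem isSCompact_preimage (h : X.IsIso Y f) {A : Set Q} (hA : Y.IsSCompact A) :
    X.IsSCompact (f ⁻¹' A) := by
  have := h.symm.isSCompact_image hA
  rwa [Equiv.image_symm_eq_preimage] at this

theorem preimage_join (h : X.IsIso Y f) (U V : Set Q) :
    f ⁻¹' Y.join U V = X.join (f ⁻¹' U) (f ⁻¹' V) := by
  apply h.bijective.1.image_injective
  simp only [join, span]
  rw [image_collSpan h.bijective.2 h.coll_iff, Set.image_union]
  simp only [Set.image_preimage_eq _ h.bijective.2]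

theorem preimage_perp (h : X.IsIso Y f) (U : Set Q) : f ⁻¹' Y.perp U = X.perp (f ⁻¹' U) := by
  ext q
  refine ⟨fun hq p hp => (h.orth_iff q p).2 (hq _ hp), fun hq p hp => ?_⟩
  obtain ⟨p, rfl⟩ := h.bijective.2 p
  exact (h.orth_iff q p).1 (hq p hp)

theorem isIsoOntoSCompactOpens_preimage (h : X.IsIso Y f) {φ : K → Set Q}
    (hφ : Y.IsIsoOntoSCompactOpens φ) : X.IsIsoOntoSCompactOpens fun a => f ⁻¹' φ a where
  injective a b hab := hφ.injective (h.bijective.2.preimage_injective hab)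
  range_eq := by
    apply Set.Subset.antisymm
    · rintro _ ⟨a, rfl⟩
      obtain ⟨ho, hc⟩ := hφ.range_eq.subset ⟨a, rfl⟩
      exact ⟨h.preimage_mem_opens_iff.2 ho, h.isSCompact_preimage hc⟩
    · rintro U ⟨ho, hc⟩
      obtain ⟨a, ha⟩ := hφ.range_eq.superset ⟨(h.open_iff U).1 ho, h.isSCompact_image hc⟩
      exact ⟨a, by simp only [ha, Set.preimage_image_eq U h.bijective.1]⟩
  map_bot := by simp [hφ.map_bot]
  map_top := by simp [hφ.map_top]
  map_inf a b := by simp [hφ.map_inf]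
  map_sup a b := by simp only [hφ.map_sup, h.preimage_join]
  map_compl a := by simp only [hφ.map_compl, h.preimage_perp]

end IsIso

end OrthoSpace

theorem theorem3p14 :
    -- the Frink space of an MOL is a Frinkian MOL-space with basis `U(a)`, and `a ↦ U(a)` is an
    -- isomorphism onto the algebra of its s-compact open subspaces
    (∀ (L : Type u) [MOL L],
      (frinkSpace L).IsFrinkian ∧
      (frinkSpace L).IsSBasis (Set.range (FrinkPoint.basic (L := L))) ∧
      (frinkSpace L).IsIsoOntoSCompactOpens (FrinkPoint.basic (L := L))) ∧
    -- the s-compact open subspaces of a Frinkian MOL-space form an MOL, a subalgebra of the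
    -- subspace lattice with `U ↦ Uᗮ`, and `p ↦ {U | p ∈ U}` is an isomorphism onto its Frink space
    (∀ (P : Type u) (X : OrthoSpace P), X.IsFrinkian →
      ∃ _ : MOL X.SCompactOpen,
        X.IsIsoOntoSCompactOpens (OrthoSpace.SCompactOpen.carrier (X := X)) ∧
        ∃ ψ : P → FrinkPoint X.SCompactOpen,
          (∀ p, (ψ p).toSet = {U | p ∈ U.carrier}) ∧ X.IsIso (frinkSpace X.SCompactOpen) ψ) ∧
    -- MOLs are isomorphic iff their Frink spaces are
    (∀ (L K : Type u) [MOL L] [MOL K],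
      MOLIsomorphic L K ↔ ∃ f, (frinkSpace L).IsIso (frinkSpace K) f) := by
  refine ⟨fun L _ => ⟨FrinkPoint.isFrinkian, FrinkPoint.isSBasis,
    FrinkPoint.isIsoOntoSCompactOpens⟩, fun P X hX => ?_, fun L K _ _ => ⟨?_, ?_⟩⟩
  · let _ := hX.molSpace.mol
    have hφ := hX.molSpace.isIsoOntoSCompactOpens_carrier
    exact ⟨hX.molSpace.mol, hφ, hφ.toFrink hX, fun _ => rfl, hφ.isIso_toFrink hX⟩
  · rintro ⟨e, he⟩
    have hφ := (FrinkPoint.isIsoOntoSCompactOpens (L := L)).comp_orderIso e.symm fun a => by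
      rw [e.symm_apply_eq, he, e.apply_symm_apply]
    exact ⟨_, hφ.isIso_toFrink FrinkPoint.isFrinkian⟩
  · rintro ⟨f, hf⟩
    exact FrinkPoint.isIsoOntoSCompactOpens.molIsomorphic
      (hf.isIsoOntoSCompactOpens_preimage FrinkPoint.isIsoOntoSCompactOpens)
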